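/- **Theorem.** There is an absolute constant $C>0$ with the following property. Let $G=(V,E)$ be a finite undirected simple graph on $n=|V|$ vertices with positive edge weights $w:E\to\mathbb{R}_{>0}$, let $t\ge 1$ be a real number, and let $T\subseteq V$ be a set of terminals. For a subgraph $H$ of $G$ (with vertex set $V$), let $d_H(u,v)$ be the minimum total weight of a path from $u$ to $v$ in $H$, and $d_H(u,v)=\infty$ if there is none. Then $G$ has a subgraph $H$ such that $$d_H(u,v)\le t\cdot d_G(u,v)\quad\text{for all }u,v\in T$$ (that is, $H$ is a $(T\times T)$-spanner of $G$ with stretch factor $t$) and $$|E(H)|\le C\left(n+\sqrt{n}\,|T|^{1+\frac{2}{t+1}}\right).$$ -/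

import Mathlib

/-- The length of a walk in a graph with edge weights `w`: the sum of the weights of its edges. -/
def walkLength {V : Type*} {G : SimpleGraph V} (w : Sym2 V → ℝ) {u v : V} (p : G.Walk u v) : ℝ :=
  (p.edges.map w).sum

/-- The weighted shortest-path distance `d_G(u,v)` (for weights that are positive on the edges
of `G`); it is `⊤` exactly when `u` and `v` are not connected in `G`. -/
noncomputable def wdist {V : Type*} (G : SimpleGraph V) (w : Sym2 V → ℝ) (u v : V) : ENNReal :=
  ⨅ p : G.Walk u v, ENNReal.ofReal (walkLength w p)

/-- `H` is a `(T × T)`-spanner of the weighted graph `(G, w)` with stretch factor `t`: it is a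
subgraph of `G` with `d_H(u,v) ≤ t * d_G(u,v)` for all terminals `u, v ∈ T`. -/
def IsSubsetSpanner {V : Type*} (G : SimpleGraph V) (w : Sym2 V → ℝ) (T : Finset V) (t : ℝ)
    (H : SimpleGraph V) : Prop :=
  H ≤ G ∧ ∀ u ∈ T, ∀ v ∈ T, wdist H w u v ≤ ENNReal.ofReal t * wdist G w u v

open SimpleGraph

/-! Process the terminal pairs by increasing distance in $G$. Whenever the current graph does not
$t$-span a pair, add a shortest path of $G$ joining it, chosen among all shortest paths to use as
few new edges as possible. The result is a spanner; what remains is to count its edges, which are at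
most $m=\sum_i |N_i|$, where $N_i$ is the set of heads of the new edges of the $i$-th path.

By the tie-break, an earlier path meets $N_h$ in at most one vertex (`inter_card_le`): two such
vertices would already be joined at their exact distance along the earlier path. Cauchy–Schwarz over
vertices then gives $m^2\le n(m+2X)$, where $X$ counts the crossings $(f,h)$ at which a later path
$h$ enters a vertex of $f$ by a new edge (`sq_sum_fresh_le`).

To bound $X$, write $t\ge 1+2\tau$. At a crossing vertex $z$ some end $c$ of $h$ was not yet joined
to $z$ with additive error $\tau\cdot\mathrm{len}(h)$, and adding $h$ makes that connection exact.
For fixed $f$ and $c$, such vertices are more than $\tau\cdot\mathrm{len}(f)/2$ apart on $f$, so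
$X\le |A||T|(2/\tau+1)$ (`card_crossings_le`). The added pairs, seen as edges on $T$, have no cycle
of length at most $2k$ when $2k\le t+1$, so the Moore bound gives $|A|\le |T|^{1+1/k}$. For $t\ge 3$
take $\tau=1$; for $1<t<3$ interpolate with the trivial bound $X\le |T|^4$, which alone suffices at
$t=1$. In all cases $X=O(|T|^{2+4/(t+1)})$. -/

/-- There is a walk from `x` to `y` in `H` of length at most `L`. -/
def WReach {V : Type*} (w : Sym2 V → ℝ) (H : SimpleGraph V) (x y : V) (L : ℝ) : Prop :=
  ∃ p : H.Walk x y, walkLength w p ≤ L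

/-! ### Weighted walks and lexicographically minimal paths. -/

section walks

variable {V : Type*} {G H K : SimpleGraph V} {w : Sym2 V → ℝ}

@[simp] lemma walkLength_nil (u : V) : walkLength w (Walk.nil : G.Walk u u) = 0 := by
  simp [walkLength]

@[simp] lemma walkLength_cons {u v x : V} (h : G.Adj u v) (p : G.Walk v x) :
    walkLength w (Walk.cons h p) = w s(u, v) + walkLength w p := by
  simp [walkLength]

@[simp] lemma walkLength_append {u v x : V} (p : G.Walk u v) (q : G.Walk v x) :
    walkLength w (p.append q) = walkLength w p + walkLength w q := by
  simp [walkLength]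

@[simp] lemma walkLength_reverse {u v : V} (p : G.Walk u v) :
    walkLength w p.reverse = walkLength w p := by
  simp [walkLength]

@[simp] lemma walkLength_mapLe {u v : V} (h : G ≤ K) (p : G.Walk u v) :
    walkLength w (p.mapLe h) = walkLength w p := by
  simp [walkLength]

lemma walkLength_nonneg (hw : ∀ e ∈ G.edgeSet, 0 ≤ w e) {u v : V} (p : G.Walk u v) :
    0 ≤ walkLength w p := by
  refine List.sum_nonneg fun x hx => ?_
  obtain ⟨e, he, rfl⟩ := List.mem_map.1 hx
  exact hw e (p.edges_subset_edgeSet he)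

lemma walkLength_bypass_le [DecidableEq V] (hw : ∀ e ∈ G.edgeSet, 0 ≤ w e) {u v : V}
    (p : G.Walk u v) : walkLength w p.bypass ≤ walkLength w p := by
  refine (p.edges_bypass_sublist_edges.map w).sum_le_sum fun x hx => ?_
  obtain ⟨e, he, rfl⟩ := List.mem_map.1 hx
  exact hw e (p.edges_subset_edgeSet he)

lemma WReach.refl (x : V) {L : ℝ} (hL : 0 ≤ L) : WReach w H x x L := ⟨.nil, by simpa⟩

lemma WReach.symm {x y : V} {L : ℝ} (h : WReach w H x y L) : WReach w H y x L := by
  obtain ⟨p, hp⟩ := h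
  exact ⟨p.reverse, by simpa⟩

lemma WReach.trans {x y z : V} {L M : ℝ} (h : WReach w H x y L) (h' : WReach w H y z M) :
    WReach w H x z (L + M) := by
  obtain ⟨p, hp⟩ := h
  obtain ⟨q, hq⟩ := h'
  exact ⟨p.append q, by simpa using add_le_add hp hq⟩

lemma WReach.mono {x y : V} {L M : ℝ} (h : WReach w H x y L) (hHK : H ≤ K) (hLM : L ≤ M) :
    WReach w K x y M := by
  obtain ⟨p, hp⟩ := h
  exact ⟨p.mapLe hHK, by simpa using hp.trans hLM⟩

/-- A walk realised simultaneously for all weight functions along a sequence of adjacent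
vertices. -/
lemma exists_walk_of_seq (v : ℕ → V) (n : ℕ) (hv : ∀ k < n, K.Adj (v k) (v (k + 1))) {i j : ℕ}
    (hij : i ≤ j) (hj : j ≤ n) :
    ∃ q : K.Walk (v i) (v j), ∀ w : Sym2 V → ℝ,
      walkLength w q = ∑ k ∈ Finset.Ico i j, w s(v k, v (k + 1)) := by
  induction j, hij using Nat.le_induction with
  | base => exact ⟨.nil, by simp⟩
  | succ j hij ih =>
    obtain ⟨q, hq⟩ := ih (by omega)
    refine ⟨q.append (.cons (hv j (by omega)) .nil), fun w => ?_⟩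
    rw [Finset.sum_Ico_succ_top hij]
    simp [hq]

lemma walkLength_eq_sum_getVert {u v : V} (p : G.Walk u v) :
    walkLength w p = ∑ k ∈ Finset.range p.length, w s(p.getVert k, p.getVert (k + 1)) := by
  induction p with
  | nil => simp
  | cons h p ih =>
    rw [walkLength_cons, Walk.length_cons, Finset.sum_range_succ', ih, add_comm]
    simp

/-- Among all walks between two vertices, some path minimises `w` and, subject to that, `w'`. -/
lemma exists_path_lex_min [Finite V] {w' : Sym2 V → ℝ} (hw : ∀ e ∈ G.edgeSet, 0 ≤ w e)
    (hw' : ∀ e ∈ G.edgeSet, 0 ≤ w' e) {a b : V} (hab : G.Reachable a b) :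
    ∃ p : G.Walk a b, p.IsPath ∧ (∀ q : G.Walk a b, walkLength w p ≤ walkLength w q) ∧
      ∀ q : G.Walk a b, walkLength w q ≤ walkLength w p → walkLength w' p ≤ walkLength w' q := by
  classical
  have := Fintype.ofFinite V
  obtain ⟨q₀⟩ := hab
  have : Nonempty (G.Path a b) := ⟨q₀.toPath⟩
  -- Paths are finite in number, and bypassing a walk increases neither weight, so minimising over
  -- paths suffices.
  obtain ⟨⟨p, hp⟩, hmin⟩ := Finite.exists_min
    (fun p : G.Path a b => toLex (walkLength w (p : G.Walk a b), walkLength w' (p : G.Walk a b)))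
  have key : ∀ q : G.Walk a b, walkLength w p < walkLength w q ∨
      (walkLength w p ≤ walkLength w q ∧ walkLength w' p ≤ walkLength w' q) := by
    intro q
    have h1 := walkLength_bypass_le hw q
    have h2 := walkLength_bypass_le hw' q
    have h := hmin ⟨q.bypass, q.bypass_isPath⟩
    rw [Prod.Lex.toLex_le_toLex] at h
    simp only at h
    rcases h with h | ⟨h, h'⟩
    · exact Or.inl (h.trans_le h1)
    · exact Or.inr ⟨h.le.trans h1, h'.trans h2⟩
  refine ⟨p, hp, fun q => ?_, fun q hq => ?_⟩
  · rcases key q with h | h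
    · exact h.le
    · exact h.1
  · rcases key q with h | h
    · exact absurd h hq.not_gt
    · exact h.2

end walks

/-! ### Adding a shortest path with few new edges. -/

/-- `K` is obtained from `H` by adding a shortest path of `G` from `a` to `b` whose vertex set is
`S` and on which `x` is at distance `pos x` from `a`; the vertices entered by
an edge outside `H` form the set `N`. -/
structure IsGeodesicExtension {V : Type*} (G : SimpleGraph V) (w : Sym2 V → ℝ)
    (H : SimpleGraph V) (a b : V) (K : SimpleGraph V) (S N : Finset V) (len : ℝ)
    (pos : V → ℝ) : Prop where
  le_graph : H ≤ K
  graph_le : K ≤ G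
  ncard_le : K.edgeSet.ncard ≤ H.edgeSet.ncard + N.card
  len_le : ∀ L, WReach w G a b L → len ≤ L
  left_mem : a ∈ S
  right_mem : b ∈ S
  pos_left : pos a = 0
  pos_right : pos b = len
  pos_nonneg : ∀ x ∈ S, 0 ≤ pos x
  pos_le : ∀ x ∈ S, pos x ≤ len
  reach : ∀ x ∈ S, ∀ y ∈ S, WReach w K x y |pos x - pos y|
  fresh_subset : N ⊆ S
  eq_of_fresh : ∀ x ∈ N, ∀ y ∈ N, WReach w H x y |pos x - pos y| → x = y

/-- The path minimises length first and the number of edges outside `H` second. The second criterion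
is what yields `eq_of_fresh`. -/
lemma exists_isGeodesicExtension {V : Type*} [Finite V] {G : SimpleGraph V} {w : Sym2 V → ℝ}
    (hw : ∀ e ∈ G.edgeSet, 0 < w e) {H : SimpleGraph V} (hH : H ≤ G) {a b : V}
    (hab : G.Reachable a b) :
    ∃ K S N len pos, IsGeodesicExtension G w H a b K S N len pos := by
  classical
  have := Fintype.ofFinite V
  set w' : Sym2 V → ℝ := fun e => if e ∈ H.edgeSet then 0 else 1 with hw'
  have hw'0 : ∀ e, 0 ≤ w' e := by intro e; simp only [hw']; split_ifs <;> norm_num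
  obtain ⟨p, hp, hmin, hmin'⟩ := exists_path_lex_min (w' := w') (fun e he => (hw e he).le)
    (fun e _ => hw'0 e) hab
  set n := p.length
  set v : ℕ → V := p.getVert
  have hinj : ∀ i ≤ n, ∀ j ≤ n, v i = v j → i = j := fun i hi j hj h => hp.getVert_injOn hi hj h
  have hadj : ∀ k < n, G.Adj (v k) (v (k + 1)) := fun k hk => p.adj_getVert_succ hk
  have hv0 : v 0 = a := p.getVert_zero
  have hvn : v n = b := p.getVert_length
  set P : ℕ → ℝ := fun i => ∑ k ∈ Finset.range i, w s(v k, v (k + 1)) with hP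
  have hlen : walkLength w p = P n := walkLength_eq_sum_getVert p
  have hpmono : ∀ i j, i ≤ j → j ≤ n → P i ≤ P j := by
    intro i j hij hj
    refine Finset.sum_le_sum_of_subset_of_nonneg (by simpa using hij) fun k hk _ => ?_
    exact (hw _ (hadj k (by simp at hk; omega))).le
  set C : SimpleGraph V := SimpleGraph.fromEdgeSet {e | ∃ k < n, e = s(v k, v (k + 1))}
  have hC : ∀ k < n, C.Adj (v k) (v (k + 1)) := fun k hk =>
    (SimpleGraph.fromEdgeSet_adj _).2 ⟨⟨k, hk, rfl⟩, (hadj k hk).ne⟩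
  have hCG : C ≤ G := by
    intro x y hxy
    obtain ⟨⟨k, hk, he⟩, -⟩ := (SimpleGraph.fromEdgeSet_adj _).1 hxy
    have := hadj k hk
    rwa [← SimpleGraph.mem_edgeSet, ← he] at this
  choose! idx hidx using show ∀ x : V, (∃ i ≤ n, v i = x) → ∃ i, i ≤ n ∧ v i = x from fun x h => h
  have hidxv : ∀ i ≤ n, idx (v i) = i := fun i hi =>
    hinj _ (hidx (v i) ⟨i, hi, rfl⟩).1 _ hi (hidx (v i) ⟨i, hi, rfl⟩).2
  set fr : Finset ℕ := (Finset.range n).filter (fun k => s(v k, v (k + 1)) ∉ H.edgeSet)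
  have seg : ∀ i j, i ≤ j → j ≤ n → WReach w (H ⊔ C) (v i) (v j) |P i - P j| := by
    intro i j hij hj
    obtain ⟨q, hq⟩ := exists_walk_of_seq v n hC hij hj
    refine ⟨q.mapLe le_sup_right, ?_⟩
    rw [walkLength_mapLe, hq, abs_sub_comm, abs_of_nonneg (sub_nonneg.2 (hpmono i j hij hj)),
      Finset.sum_Ico_eq_sub _ hij]
  -- The segment from `v i` to `v j` contains the new edge into `v j`. Replacing it by an `H`-walk
  -- of no greater length would keep the total length minimal and lower `w'`, against the tie-break.
  -- Recording heads of new edges ensures that the later vertex always has its new edge inside the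
  -- segment.
  have fresh : ∀ i j, i < j → j ≤ n → s(v (j - 1), v j) ∉ H.edgeSet →
      ¬ WReach w H (v i) (v j) |P i - P j| := by
    rintro i j hij hj hnew ⟨r, hr⟩
    rw [abs_sub_comm, abs_of_nonneg (sub_nonneg.2 (hpmono i j hij.le hj))] at hr
    obtain ⟨q₁, hq₁⟩ := exists_walk_of_seq v n hadj (Nat.zero_le i) (by omega)
    obtain ⟨q₂, hq₂⟩ := exists_walk_of_seq v n hadj hj le_rfl
    have hrw : walkLength w' r = 0 := by
      refine List.sum_eq_zero fun x hx => ?_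
      obtain ⟨e, he, rfl⟩ := List.mem_map.1 hx
      simp [hw', r.edges_subset_edgeSet he]
    have h := hmin' (((q₁.append (r.mapLe hH)).append q₂).copy hv0 hvn) (by
      have : walkLength w (((q₁.append (r.mapLe hH)).append q₂).copy hv0 hvn) =
          walkLength w ((q₁.append (r.mapLe hH)).append q₂) := by simp [walkLength]
      rw [this, hlen, walkLength_append, walkLength_append, walkLength_mapLe, hq₁, hq₂,
        Finset.sum_Ico_eq_sub _ hj, Finset.sum_Ico_eq_sub _ (Nat.zero_le i)]
      simp only [Finset.range_zero, Finset.sum_empty]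
      simp only [hP] at hr ⊢
      linarith)
    have : walkLength w' (((q₁.append (r.mapLe hH)).append q₂).copy hv0 hvn) =
          walkLength w' ((q₁.append (r.mapLe hH)).append q₂) := by simp [walkLength]
    rw [this, walkLength_append, walkLength_append, walkLength_mapLe, hq₁, hq₂, hrw,
      walkLength_eq_sum_getVert, Finset.range_eq_Ico,
      ← Finset.sum_Ico_consecutive _ (Nat.zero_le j) hj,
      ← Finset.sum_Ico_consecutive _ (Nat.zero_le i) hij.le] at h
    have h1 : w' s(v (j - 1), v (j - 1 + 1)) ≤
        ∑ k ∈ Finset.Ico i j, w' s(v k, v (k + 1)) :=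
      Finset.single_le_sum (f := fun k => w' s(v k, v (k + 1))) (fun k _ => hw'0 _)
        (by simp; omega)
    have h2 : w' s(v (j - 1), v (j - 1 + 1)) = 1 := by
      rw [Nat.sub_add_cancel (by omega)]
      simp [hw', hnew]
    linarith
  refine ⟨H ⊔ C, (Finset.range (n + 1)).image v, fr.image (fun k => v (k + 1)), P n,
    fun x => P (idx x), ?_⟩
  refine ⟨le_sup_left, sup_le hH hCG, ?_, ?_, ?_, ?_, ?_, ?_, ?_, ?_, ?_, ?_, ?_⟩
  · rw [Finset.card_image_of_injOn]
    · have hsub : (H ⊔ C).edgeSet ⊆ H.edgeSet ∪ ((fr.image fun k => s(v k, v (k + 1)) :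
          Finset (Sym2 V)) : Set (Sym2 V)) := by
        intro e he
        rw [SimpleGraph.edgeSet_sup] at he
        by_cases heH : e ∈ H.edgeSet
        · exact Or.inl heH
        · have he' := he.resolve_left heH
          rw [SimpleGraph.edgeSet_fromEdgeSet] at he'
          obtain ⟨⟨k, hk, rfl⟩, -⟩ := he'
          refine Or.inr (Finset.mem_coe.2 (Finset.mem_image.2 ⟨k, ?_, rfl⟩))
          exact Finset.mem_filter.2 ⟨Finset.mem_range.2 hk, heH⟩
      refine (Set.ncard_le_ncard hsub (Set.toFinite _)).trans ((Set.ncard_union_le _ _).trans ?_)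
      rw [Set.ncard_coe_finset]
      exact Nat.add_le_add_left Finset.card_image_le _
    · intro i hi j hj h
      have hi' := Finset.mem_range.1 (Finset.mem_filter.1 hi).1
      have hj' := Finset.mem_range.1 (Finset.mem_filter.1 hj).1
      have := hinj (i + 1) (by omega) (j + 1) (by omega) h
      omega
  · rintro L ⟨q, hq⟩
    exact hlen ▸ (hmin q).trans hq
  · exact Finset.mem_image.2 ⟨0, by simp, hv0⟩
  · exact Finset.mem_image.2 ⟨n, by simp, hvn⟩
  · have := hidxv 0 (Nat.zero_le n)
    rw [hv0] at this
    simp [this, hP]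
  · have := hidxv n le_rfl
    rw [hvn] at this
    simp [this]
  · intro x hx
    obtain ⟨i, hi, rfl⟩ := Finset.mem_image.1 hx
    have hi' : i ≤ n := by simp at hi; omega
    simpa [hidxv i hi', hP] using hpmono 0 i (Nat.zero_le i) hi'
  · intro x hx
    obtain ⟨i, hi, rfl⟩ := Finset.mem_image.1 hx
    have hi' : i ≤ n := by simp at hi; omega
    simpa [hidxv i hi'] using hpmono i n hi' le_rfl
  · intro x hx y hy
    obtain ⟨i, hi, rfl⟩ := Finset.mem_image.1 hx
    obtain ⟨j, hj, rfl⟩ := Finset.mem_image.1 hy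
    have hi' : i ≤ n := by simp at hi; omega
    have hj' : j ≤ n := by simp at hj; omega
    simp only [hidxv i hi', hidxv j hj']
    rcases le_total i j with h | h
    · exact seg i j h hj'
    · rw [abs_sub_comm]
      exact (seg j i h hi').symm
  · intro x hx
    obtain ⟨k, hk, rfl⟩ := Finset.mem_image.1 hx
    have hk' := Finset.mem_range.1 (Finset.mem_filter.1 hk).1
    exact Finset.mem_image.2 ⟨k + 1, by simpa using hk', rfl⟩
  · intro x hx y hy h
    obtain ⟨i, hi, rfl⟩ := Finset.mem_image.1 hx
    obtain ⟨j, hj, rfl⟩ := Finset.mem_image.1 hy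
    obtain ⟨hi', hin⟩ := Finset.mem_filter.1 hi
    obtain ⟨hj', hjn⟩ := Finset.mem_filter.1 hj
    rw [Finset.mem_range] at hi' hj'
    simp only [hidxv (i + 1) hi', hidxv (j + 1) hj'] at h
    rcases lt_trichotomy i j with hij | rfl | hij
    · exact absurd h (fresh (i + 1) (j + 1) (by omega) hj' (by simpa using hjn))
    · rfl
    · rw [abs_sub_comm] at h
      exact absurd h.symm (fresh (j + 1) (i + 1) (by omega) hi' (by simpa using hin))

/-! ### Distances, and positions along a shortest path. -/

section distance

variable {V : Type*} {G H : SimpleGraph V} {w : Sym2 V → ℝ}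

lemma WReach.wdist_le {x y : V} {L : ℝ} (h : WReach w H x y L) :
    wdist H w x y ≤ ENNReal.ofReal L := by
  obtain ⟨p, hp⟩ := h
  exact (iInf_le _ p).trans (ENNReal.ofReal_le_ofReal hp)

lemma ofReal_le_wdist {x y : V} {ℓ : ℝ} (h : ∀ L, WReach w G x y L → ℓ ≤ L) :
    ENNReal.ofReal ℓ ≤ wdist G w x y :=
  le_iInf fun p => ENNReal.ofReal_le_ofReal (h _ ⟨p, le_rfl⟩)

lemma WReach.pos_of_ne (hw : ∀ e ∈ G.edgeSet, 0 < w e) {x y : V} {L : ℝ}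
    (h : WReach w G x y L) (hxy : x ≠ y) : 0 < L := by
  obtain ⟨p, hp⟩ := h
  refine lt_of_lt_of_le ?_ hp
  cases p with
  | nil => exact absurd rfl hxy
  | cons hadj q =>
    rw [walkLength_cons]
    exact add_pos_of_pos_of_nonneg (hw _ hadj) (walkLength_nonneg (fun e he => (hw e he).le) q)

lemma IsGeodesicExtension.len_nonneg {a b : V} {K : SimpleGraph V} {S N : Finset V} {len : ℝ}
    {pos : V → ℝ} (h : IsGeodesicExtension G w H a b K S N len pos) : 0 ≤ len :=
  h.pos_right ▸ h.pos_nonneg b h.right_mem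

lemma IsGeodesicExtension.reach_ends {a b : V} {K : SimpleGraph V} {S N : Finset V} {len : ℝ}
    {pos : V → ℝ} (h : IsGeodesicExtension G w H a b K S N len pos) : WReach w K a b len := by
  have := h.reach a h.left_mem b h.right_mem
  rwa [h.pos_left, h.pos_right, zero_sub, abs_neg, abs_of_nonneg h.len_nonneg] at this

/-- A connection in `G` shorter than the difference of positions would be a shortcut from `a` to
`b`, contradicting `len_le`. -/
lemma IsGeodesicExtension.abs_sub_le {a b : V} {K : SimpleGraph V} {S N : Finset V} {len : ℝ}
    {pos : V → ℝ} (h : IsGeodesicExtension G w H a b K S N len pos) {x y : V} (hx : x ∈ S)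
    (hy : y ∈ S) {L : ℝ} (hL : WReach w G x y L) : |pos x - pos y| ≤ L := by
  have key : ∀ x ∈ S, ∀ y ∈ S, WReach w G x y L → pos y - pos x ≤ L := by
    intro x hx y hy hL
    have h1 := (h.reach a h.left_mem x hx).mono h.graph_le le_rfl
    have h2 := (h.reach y hy b h.right_mem).mono h.graph_le le_rfl
    rw [h.pos_left, zero_sub, abs_neg, abs_of_nonneg (h.pos_nonneg x hx)] at h1
    rw [h.pos_right, abs_sub_comm, abs_of_nonneg (sub_nonneg.2 (h.pos_le y hy))] at h2
    have := h.len_le _ ((h1.trans hL).trans h2)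
    linarith
  rw [abs_le]
  constructor
  · linarith [key x hx y hy hL]
  · exact key y hy x hx hL.symm

end distance

/-! ### The greedy algorithm. -/

/-- A run of the greedy algorithm: at each time `i ∈ A` the current graph `H i` does not
`t`-span the terminal pair `(a i, b i)`, and a shortest path of `G` between them is added.
The lengths of the added paths increase. -/
structure IsGreedyRun {V : Type*} (G : SimpleGraph V) (w : Sym2 V → ℝ) (T : Finset V) (t : ℝ)
    (A : Finset ℕ) (H : ℕ → SimpleGraph V) (a b : ℕ → V) (S N : ℕ → Finset V) (len : ℕ → ℝ)
    (pos : ℕ → V → ℝ) : Prop where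
  ext : ∀ i ∈ A, IsGeodesicExtension G w (H i) (a i) (b i) (H (i + 1)) (S i) (N i) (len i) (pos i)
  mono : Monotone H
  le : ∀ i, H i ≤ G
  zero : H 0 = ⊥
  succ : ∀ i ∉ A, H (i + 1) = H i
  not_reach : ∀ i ∈ A, ¬ WReach w (H i) (a i) (b i) (t * len i)
  len_mono : ∀ i ∈ A, ∀ j ∈ A, i ≤ j → len i ≤ len j
  len_pos : ∀ i ∈ A, 0 < len i
  left_mem : ∀ i ∈ A, a i ∈ T
  right_mem : ∀ i ∈ A, b i ∈ T

lemma exists_enum_monotone {α β : Type*} [Nonempty α] [LinearOrder β] (s : Finset α) (f : α → β) :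
    ∃ (M : ℕ) (e : ℕ → α), (∀ i < M, e i ∈ s) ∧ (∀ x ∈ s, ∃ i < M, e i = x) ∧
      ∀ i j, i ≤ j → j < M → f (e i) ≤ f (e j) := by
  classical
  let e₀ : Fin s.card → α := fun k => (s.equivFin.symm k : s)
  let σ := Tuple.sort (f ∘ e₀)
  refine ⟨s.card, fun i => if h : i < s.card then e₀ (σ ⟨i, h⟩) else Classical.arbitrary α,
    ?_, ?_, ?_⟩
  · intro i hi
    simp [hi, e₀]
  · intro x hx
    refine ⟨(σ.symm (s.equivFin ⟨x, hx⟩) : Fin s.card), Fin.is_lt _, ?_⟩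
    simp [e₀]
  · intro i j hij hj
    have := Tuple.monotone_sort (f ∘ e₀) (show (⟨i, hij.trans_lt hj⟩ : Fin s.card) ≤ ⟨j, hj⟩ from hij)
    simpa [hj, hij.trans_lt hj, σ] using this

lemma exists_isGreedyRun {V : Type*} [Finite V] [Nonempty V] {G : SimpleGraph V} {w : Sym2 V → ℝ}
    (hw : ∀ e ∈ G.edgeSet, 0 < w e) {t : ℝ} (ht : 1 ≤ t) (T : Finset V) :
    ∃ A H a b S N len pos M, IsGreedyRun G w T t A H a b S N len pos ∧
      IsSubsetSpanner G w T t (H M) := by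
  classical
  obtain ⟨M, e, heT, hsurj, hmono⟩ :=
    exists_enum_monotone T.offDiag (fun x => wdist G w x.1 x.2)
  set a : ℕ → V := fun i => (e i).1
  set b : ℕ → V := fun i => (e i).2
  -- Even when a pair is skipped, `len` is kept as a lower bound on its distance in `G`; this
  -- certifies the stretch at the end. The zero values are dummies.
  have step : ∀ (i : ℕ) (H : {H : SimpleGraph V // H ≤ G}), ∃ (K : {K : SimpleGraph V // K ≤ G})
      (S N : Finset V) (len : ℝ) (pos : V → ℝ),
      (i < M ∧ IsGeodesicExtension G w H (a i) (b i) K S N len pos ∧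
        ¬ WReach w H (a i) (b i) (t * len)) ∨
      (K = H ∧ (i < M → G.Reachable (a i) (b i) →
        (∀ L, WReach w G (a i) (b i) L → len ≤ L) ∧ WReach w H.1 (a i) (b i) (t * len))) := by
    rintro i ⟨H, hH⟩
    by_cases hr : i < M ∧ G.Reachable (a i) (b i)
    · obtain ⟨K, S, N, len, pos, hE⟩ := exists_isGeodesicExtension hw hH hr.2
      by_cases hc : WReach w H (a i) (b i) (t * len)
      · exact ⟨⟨H, hH⟩, S, N, len, pos, Or.inr ⟨rfl, fun _ _ => ⟨hE.len_le, hc⟩⟩⟩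
      · exact ⟨⟨K, hE.graph_le⟩, S, N, len, pos, Or.inl ⟨hr.1, hE, hc⟩⟩
    · exact ⟨⟨H, hH⟩, ∅, ∅, 0, 0, Or.inr ⟨rfl, fun h h' => absurd ⟨h, h'⟩ hr⟩⟩
  choose K S N len pos hstep using step
  let H : ℕ → {H : SimpleGraph V // H ≤ G} := fun n => Nat.rec ⟨⊥, bot_le⟩ K n
  have hHs : ∀ i, H (i + 1) = K i (H i) := fun i => rfl
  -- The choice forgets which alternative was taken. `A` tests the first one, so outside `A` the
  -- second must hold.
  set A : Finset ℕ := (Finset.range M).filter fun i =>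
    IsGeodesicExtension G w (H i).1 (a i) (b i) (K i (H i)).1 (S i (H i)) (N i (H i))
      (len i (H i)) (pos i (H i)) ∧ ¬ WReach w (H i).1 (a i) (b i) (t * len i (H i))
  have hAext : ∀ i ∈ A, IsGeodesicExtension G w (H i).1 (a i) (b i) (H (i + 1)).1 (S i (H i))
      (N i (H i)) (len i (H i)) (pos i (H i)) := fun i hi => (Finset.mem_filter.1 hi).2.1
  have hAM : ∀ i ∈ A, i < M := fun i hi => Finset.mem_range.1 (Finset.mem_filter.1 hi).1
  have hne : ∀ i < M, a i ≠ b i := fun i hi => (Finset.mem_offDiag.1 (heT i hi)).2.2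
  have hnot : ∀ i ∉ A, H (i + 1) = H i ∧ (i < M → G.Reachable (a i) (b i) →
      (∀ L, WReach w G (a i) (b i) L → len i (H i) ≤ L) ∧
        WReach w (H i).1 (a i) (b i) (t * len i (H i))) := by
    intro i hi
    rcases hstep i (H i) with h | h
    · exact absurd (Finset.mem_filter.2 ⟨Finset.mem_range.2 h.1, h.2⟩) hi
    · exact ⟨(hHs i).trans h.1, h.2⟩
  have hHmono : Monotone fun i => (H i).1 := by
    refine monotone_nat_of_le_succ fun i => ?_
    by_cases hi : i ∈ A
    · exact (hAext i hi).le_graph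
    · exact (congrArg Subtype.val (hnot i hi).1).ge
  refine ⟨A, fun i => (H i).1, a, b, fun i => S i (H i), fun i => N i (H i),
    fun i => len i (H i), fun i => pos i (H i), M, ⟨hAext, hHmono, fun i => (H i).2, rfl,
      fun i hi => congrArg Subtype.val (hnot i hi).1, fun i hi => (Finset.mem_filter.1 hi).2.2,
      ?_, ?_, ?_, ?_⟩, (H M).2, ?_⟩
  · intro i hi j hj hij
    have h1 := ofReal_le_wdist (hAext i hi).len_le
    have h2 := ((hAext j hj).reach_ends.mono (hAext j hj).graph_le le_rfl).wdist_le
    exact (ENNReal.ofReal_le_ofReal_iff (hAext j hj).len_nonneg).1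
      ((h1.trans (hmono i j hij (hAM j hj))).trans h2)
  · intro i hi
    exact ((hAext i hi).reach_ends.mono (hAext i hi).graph_le le_rfl).pos_of_ne hw
      (hne i (hAM i hi))
  · exact fun i hi => (Finset.mem_offDiag.1 (heT i (hAM i hi))).1
  · exact fun i hi => (Finset.mem_offDiag.1 (heT i (hAM i hi))).2.1
  · intro u hu v hv
    rcases eq_or_ne u v with rfl | huv
    · exact ((WReach.refl u le_rfl).wdist_le.trans (by simp)).trans zero_le
    obtain ⟨i, hi, hie⟩ := hsurj (u, v) (Finset.mem_offDiag.2 ⟨hu, hv, huv⟩)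
    have hau : a i = u := congrArg Prod.fst hie
    have hbv : b i = v := congrArg Prod.snd hie
    rw [← hau, ← hbv]
    by_cases hr : G.Reachable (a i) (b i)
    · have main : ∃ ℓ, (∀ L, WReach w G (a i) (b i) L → ℓ ≤ L) ∧
          WReach w (H M).1 (a i) (b i) (t * ℓ) := by
        by_cases hA : i ∈ A
        · refine ⟨_, (hAext i hA).len_le, (hAext i hA).reach_ends.mono (hHmono hi) ?_⟩
          exact le_mul_of_one_le_left (hAext i hA).len_nonneg ht
        · obtain ⟨h1, h2⟩ := (hnot i hA).2 hi hr
          exact ⟨_, h1, h2.mono (hHmono hi.le) le_rfl⟩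
      obtain ⟨ℓ, h1, h2⟩ := main
      refine h2.wdist_le.trans ?_
      rw [ENNReal.ofReal_mul (by linarith)]
      gcongr
      exact ofReal_le_wdist h1
    · have : wdist G w (a i) (b i) = ⊤ := by
        rw [wdist, iInf_eq_top]
        exact fun p => absurd ⟨p⟩ hr
      rw [this, ENNReal.mul_top (by simpa using by linarith)]
      exact le_top

/-! ### Two counting lemmas: separated points and a second moment. -/

lemma card_le_of_pairwise_lt_abs_sub {ι : Type*} (Y : Finset ι) (x : ι → ℝ) {ℓ δ : ℝ}
    (hδ : 0 < δ) (hℓ : 0 ≤ ℓ) (h0 : ∀ i ∈ Y, 0 ≤ x i) (h1 : ∀ i ∈ Y, x i ≤ ℓ)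
    (hsep : ∀ i ∈ Y, ∀ j ∈ Y, i ≠ j → δ < |x i - x j|) : (Y.card : ℝ) ≤ ℓ / δ + 1 := by
  have hmaps : Set.MapsTo (fun i => ⌊x i / δ⌋₊) Y (Finset.range (⌊ℓ / δ⌋₊ + 1)) := by
    intro i hi
    simp only [Finset.coe_range, Set.mem_Iio, Nat.lt_succ_iff]
    exact Nat.floor_le_floor (by gcongr; exact h1 i hi)
  have hinj : Set.InjOn (fun i => ⌊x i / δ⌋₊) Y := by
    intro i hi j hj hij
    by_contra hne
    have hs := hsep i hi j hj hne
    have a1 := Nat.floor_le (div_nonneg (h0 i hi) hδ.le)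
    have a2 := Nat.lt_floor_add_one (x i / δ)
    have b1 := Nat.floor_le (div_nonneg (h0 j hj) hδ.le)
    have b2 := Nat.lt_floor_add_one (x j / δ)
    simp only at hij
    rw [hij] at a1 a2
    have : |x i / δ - x j / δ| < 1 := by
      rw [abs_lt]
      constructor <;> linarith
    rw [← sub_div, abs_div, abs_of_pos hδ, div_lt_one hδ] at this
    exact lt_asymm this hs
  have := Finset.card_le_card_of_injOn _ hmaps hinj
  rw [Finset.card_range] at this
  calc (Y.card : ℝ) ≤ (⌊ℓ / δ⌋₊ : ℝ) + 1 := by exact_mod_cast this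
    _ ≤ ℓ / δ + 1 := by
      gcongr
      exact Nat.floor_le (div_nonneg hℓ hδ.le)

/-- Cauchy–Schwarz for the multiplicity function counting how many `N i` contain a vertex: its sum
is the left-hand total, its sum of squares counts pairwise intersections. -/
lemma sum_card_sq_le {ι V : Type*} [Fintype V] [DecidableEq V] (A : Finset ι) (N : ι → Finset V) :
    (∑ i ∈ A, (N i).card) ^ 2 ≤ Fintype.card V * ∑ i ∈ A, ∑ j ∈ A, (N i ∩ N j).card := by
  have h1 : ∑ i ∈ A, (N i).card = ∑ z : V, ∑ i ∈ A, if z ∈ N i then 1 else 0 := by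
    rw [Finset.sum_comm]
    simp
  have h2 : ∑ i ∈ A, ∑ j ∈ A, (N i ∩ N j).card =
      ∑ z : V, (∑ i ∈ A, if z ∈ N i then 1 else 0) ^ 2 := by
    simp_rw [sq, Finset.sum_mul_sum]
    rw [Finset.sum_comm (s := Finset.univ)]
    refine Finset.sum_congr rfl fun i _ => ?_
    rw [Finset.sum_comm]
    refine Finset.sum_congr rfl fun j _ => ?_
    simp_rw [ite_zero_mul_ite_zero, mul_one, ← Finset.mem_inter]
    rw [Finset.sum_boole, Finset.filter_univ_mem, Nat.cast_id]
  rw [h1, h2]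
  exact sq_sum_le_card_mul_sum_sq

/-! ### Crossings of the added paths. -/

section greedy

variable {V : Type*} {G : SimpleGraph V} {w : Sym2 V → ℝ} {T : Finset V} {t : ℝ}
  {A : Finset ℕ} {H : ℕ → SimpleGraph V} {a b : ℕ → V} {S N : ℕ → Finset V} {len : ℕ → ℝ}
  {pos : ℕ → V → ℝ}

/-- Pairs `(f, h)` of added paths, `f` before `h`, such that `h` enters a vertex of `f` by an edge
that was not yet present. -/
def crossings {V : Type*} [DecidableEq V] (A : Finset ℕ) (S N : ℕ → Finset V) : Finset (ℕ × ℕ) :=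
  (A ×ˢ A).filter fun p => p.1 < p.2 ∧ (S p.1 ∩ N p.2).Nonempty

namespace IsGreedyRun

lemma ncard_edgeSet_le (R : IsGreedyRun G w T t A H a b S N len pos) {M : ℕ} :
    (H M).edgeSet.ncard ≤ ∑ i ∈ A, (N i).card := by
  have key : ∀ n, (H n).edgeSet.ncard ≤ ∑ i ∈ A.filter (· < n), (N i).card := by
    intro n
    induction n with
    | zero => simp [R.zero]
    | succ n ih =>
      by_cases hn : n ∈ A
      · have : A.filter (· < n + 1) = insert n (A.filter (· < n)) := by
          ext i
          simp only [Finset.mem_filter, Finset.mem_insert]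
          constructor
          · rintro ⟨h, h'⟩
            rcases Nat.lt_succ_iff_lt_or_eq.1 h' with h'' | rfl
            · exact Or.inr ⟨h, h''⟩
            · exact Or.inl rfl
          · rintro (rfl | ⟨h, h'⟩)
            · exact ⟨hn, by omega⟩
            · exact ⟨h, by omega⟩
        rw [this, Finset.sum_insert (by simp)]
        have := (R.ext n hn).ncard_le
        omega
      · rw [R.succ n hn]
        refine ih.trans (Finset.sum_le_sum_of_subset fun i hi => ?_)
        simp only [Finset.mem_filter] at hi ⊢
        exact ⟨hi.1, by omega⟩
  exact (key M).trans (Finset.sum_le_sum_of_subset (Finset.filter_subset _ _))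

/-- If both ends of path `h` reached `z` with excess at most `τ * len h`, joining the two walks
would give length `(1 + 2 * τ) * len h`, at most `t * len h`, and the pair would have been skipped.
The number `L` is the distance from `c` to `z` in `G`. -/
lemma exists_bad_end (R : IsGreedyRun G w T t A H a b S N len pos) {τ : ℝ} (ht : 1 + 2 * τ ≤ t)
    {h : ℕ} (hh : h ∈ A) {z : V} (hz : z ∈ S h) :
    ∃ c ∈ T, ∃ L, (∀ L', WReach w G c z L' → L ≤ L') ∧ WReach w (H (h + 1)) c z L ∧
      ¬ WReach w (H h) c z (L + τ * len h) := by
  have E := R.ext h hh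
  have hp0 := E.pos_nonneg z hz
  have hp1 := E.pos_le z hz
  by_cases hA : WReach w (H h) (a h) z (pos h z + τ * len h)
  · refine ⟨b h, R.right_mem h hh, len h - pos h z, fun L' hL' => ?_, ?_, fun hB => ?_⟩
    · have := E.abs_sub_le E.right_mem hz hL'
      rw [E.pos_right, abs_of_nonneg (by linarith)] at this
      exact this
    · have := E.reach _ E.right_mem z hz
      rwa [E.pos_right, abs_of_nonneg (by linarith)] at this
    · refine R.not_reach h hh ((hA.trans hB.symm).mono le_rfl ?_)
      have := mul_le_mul_of_nonneg_right ht (R.len_pos h hh).le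
      linarith
  · refine ⟨a h, R.left_mem h hh, pos h z, fun L' hL' => ?_, ?_, hA⟩
    · have := E.abs_sub_le E.left_mem hz hL'
      rw [E.pos_left, zero_sub, abs_neg, abs_of_nonneg hp0] at this
      exact this
    · have := E.reach _ E.left_mem z hz
      rwa [E.pos_left, zero_sub, abs_neg, abs_of_nonneg hp0] at this

variable [DecidableEq V]

/-- Two common vertices would be joined inside `H h`, along the earlier path `f`, at their exact
distance in `G`; `eq_of_fresh` forbids this. -/
lemma inter_card_le (R : IsGreedyRun G w T t A H a b S N len pos) {f h : ℕ} (hf : f ∈ A)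
    (hh : h ∈ A) (hfh : f < h) : (S f ∩ N h).card ≤ 1 := by
  refine Finset.card_le_one.2 fun x hx y hy => ?_
  rw [Finset.mem_inter] at hx hy
  have Eh := R.ext h hh
  have Ef := R.ext f hf
  refine Eh.eq_of_fresh x hx.2 y hy.2 ?_
  have h1 := (Eh.reach x (Eh.fresh_subset hx.2) y (Eh.fresh_subset hy.2)).mono Eh.graph_le le_rfl
  exact (Ef.reach x hx.1 y hy.1).mono (R.mono hfh) (Ef.abs_sub_le hx.1 hy.1 h1)

/-- In the double sum of intersections the diagonal contributes the first term. An off-diagonal pair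
contributes at most one, and only if it is a crossing in time order. -/
lemma sq_sum_fresh_le [Fintype V] (R : IsGreedyRun G w T t A H a b S N len pos) :
    (∑ i ∈ A, (N i).card) ^ 2 ≤
      Fintype.card V * (∑ i ∈ A, (N i).card + 2 * (crossings A S N).card) := by
  refine (sum_card_sq_le A N).trans (Nat.mul_le_mul_left _ ?_)
  set X := crossings A S N with hX
  have hlt : ∀ i ∈ A, ∀ j ∈ A, i < j →
      (N i ∩ N j).card ≤ if (i, j) ∈ X then 1 else 0 := by
    intro i hi j hj hij
    have hsub : N i ∩ N j ⊆ S i ∩ N j :=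
      Finset.inter_subset_inter_right (R.ext i hi).fresh_subset
    split_ifs with hx
    · exact (Finset.card_le_card hsub).trans (R.inter_card_le hi hj hij)
    · rw [Nat.le_zero, Finset.card_eq_zero, ← Finset.not_nonempty_iff_eq_empty]
      intro hne
      exact hx (by simpa [hX, crossings, hi, hj, hij] using hne.mono hsub)
  have hpt : ∀ i ∈ A, ∀ j ∈ A, (N i ∩ N j).card ≤ (if i = j then (N i).card else 0) +
      ((if (i, j) ∈ X then 1 else 0) + if (j, i) ∈ X then 1 else 0) := by
    intro i hi j hj
    rcases lt_trichotomy i j with hij | rfl | hij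
    · have := hlt i hi j hj hij
      omega
    · simp
    · have := hlt j hj i hi hij
      rw [Finset.inter_comm] at this
      omega
  have hXA : ∑ i ∈ A, ∑ j ∈ A, (if (i, j) ∈ X then 1 else 0) = X.card := by
    rw [← Finset.sum_product', Finset.sum_boole, Nat.cast_id]
    congr 1
    ext p
    simp only [Finset.mem_filter, hX, crossings]
    tauto
  have hXA' : ∑ i ∈ A, ∑ j ∈ A, (if (j, i) ∈ X then 1 else 0) = X.card := by
    rw [Finset.sum_comm, hXA]
  calc ∑ i ∈ A, ∑ j ∈ A, (N i ∩ N j).card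
      ≤ ∑ i ∈ A, ∑ j ∈ A, ((if i = j then (N i).card else 0) +
          ((if (i, j) ∈ X then 1 else 0) + if (j, i) ∈ X then 1 else 0)) :=
        Finset.sum_le_sum fun i hi => Finset.sum_le_sum fun j hj => hpt i hi j hj
    _ = ∑ i ∈ A, (N i).card + 2 * X.card := by
        simp only [Finset.sum_add_distrib, hXA, hXA']
        rw [two_mul]
        congr 1
        exact Finset.sum_congr rfl fun i hi => by simp [hi]

/-- Charge each crossing to its earlier path and its bad end. The crossings charged to the same pair
sit at well separated positions on the earlier path, so there are at most `2 / τ + 1` of them. -/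
lemma card_crossings_le (R : IsGreedyRun G w T t A H a b S N len pos) {τ : ℝ} (hτ : 0 < τ)
    (ht : 1 + 2 * τ ≤ t) :
    ((crossings A S N).card : ℝ) ≤ A.card * (T.card * (2 / τ + 1)) := by
  classical
  have hz : ∀ p : ℕ × ℕ, p ∈ crossings A S N → ∃ z, z ∈ S p.1 ∧ z ∈ S p.2 := by
    intro p hp
    obtain ⟨hp, hlt, z, hz⟩ := Finset.mem_filter.1 hp
    rw [Finset.mem_inter] at hz
    exact ⟨z, hz.1, (R.ext _ (Finset.mem_product.1 hp).2).fresh_subset hz.2⟩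
  have hz' : ∀ p : ℕ × ℕ, ∃ z, ∃ c, p ∈ crossings A S N → z ∈ S p.1 ∧ c ∈ T ∧
      ∃ L, (∀ L', WReach w G c z L' → L ≤ L') ∧ WReach w (H (p.2 + 1)) c z L ∧
      ¬ WReach w (H p.2) c z (L + τ * len p.2) := by
    intro p
    by_cases hp : p ∈ crossings A S N
    · obtain ⟨z, h1, h2⟩ := hz p hp
      obtain ⟨c, hc, h⟩ := R.exists_bad_end ht
        (Finset.mem_product.1 (Finset.mem_filter.1 hp).1).2 h2
      exact ⟨z, c, fun _ => ⟨h1, hc, h⟩⟩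
    · exact ⟨a 0, a 0, fun h => absurd h hp⟩
  choose z c hzc using hz'
  have hmaps : Set.MapsTo (fun p => (p.1, c p)) (crossings A S N : Set (ℕ × ℕ))
      (A ×ˢ T : Finset (ℕ × V)) := by
    intro p hp
    exact Finset.mem_coe.2 (Finset.mem_product.2
      ⟨(Finset.mem_product.1 (Finset.mem_filter.1 hp).1).1, (hzc p hp).2.1⟩)
  have hfib : ∀ q ∈ A ×ˢ T,
      (((crossings A S N).filter fun p => (p.1, c p) = q).card : ℝ) ≤ 2 / τ + 1 := by
    rintro ⟨f, x⟩ hq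
    obtain ⟨hf, hx⟩ := Finset.mem_product.1 hq
    have E := R.ext f hf
    have hℓ := R.len_pos f hf
    have hδ : 0 < τ * len f / 2 := by positivity
    have hmem : ∀ p ∈ (crossings A S N).filter (fun p => (p.1, c p) = (f, x)),
        p ∈ crossings A S N ∧ p.1 = f ∧ c p = x := by
      intro p hp
      obtain ⟨h1, h2⟩ := Finset.mem_filter.1 hp
      exact ⟨h1, (Prod.ext_iff.1 h2).1, (Prod.ext_iff.1 h2).2⟩
    have hsep : ∀ p ∈ (crossings A S N).filter (fun p => (p.1, c p) = (f, x)),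
        ∀ q ∈ (crossings A S N).filter (fun p => (p.1, c p) = (f, x)), p.2 < q.2 →
        τ * len f / 2 < |pos f (z p) - pos f (z q)| := by
      intro p hp q hq hpq
      obtain ⟨hpX, hp1, hpc⟩ := hmem p hp
      obtain ⟨hqX, hq1, hqc⟩ := hmem q hq
      obtain ⟨hzp, -, L, hL, hLr, -⟩ := hzc p hpX
      obtain ⟨hzq, -, L', hL', hLr', hbad⟩ := hzc q hqX
      rw [hp1] at hzp
      rw [hq1] at hzq
      rw [hpc] at hL hLr
      rw [hqc] at hL' hLr' hbad
      obtain ⟨hqA, hqlt, -⟩ := Finset.mem_filter.1 hqX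
      have hq2 := (Finset.mem_product.1 hqA).2
      have hlen : len f ≤ len q.2 := R.len_mono f hf _ hq2 (by omega)
      by_contra hle
      rw [not_lt] at hle
      have hfr := E.reach _ hzp _ hzq
      have hLL : L ≤ L' + |pos f (z p) - pos f (z q)| :=
        hL _ ((hLr'.mono (R.le _) le_rfl).trans (hfr.symm.mono (R.le _) le_rfl))
      -- The detour from `c` to `z p`, then along `f` to `z q`, costs at most `L'` plus twice the
      -- gap: once for travelling along `f`, once for `L` exceeding `L'`. Hence the separation `τ *
      -- len f / 2`; ordering by length turns `len f` into `len q.2`.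
      refine hbad (((hLr.mono (R.mono hpq) le_rfl).trans
        (hfr.mono (R.mono (show f + 1 ≤ q.2 by omega)) le_rfl)).mono le_rfl ?_)
      have : τ * len f ≤ τ * len q.2 := by gcongr
      linarith
    have := card_le_of_pairwise_lt_abs_sub
      ((crossings A S N).filter fun p => (p.1, c p) = (f, x)) (fun p => pos f (z p)) hδ hℓ.le
      (fun p hp => ?_) (fun p hp => ?_) (fun p hp q hq hpq => ?_)
    · refine this.trans (le_of_eq ?_)
      field_simp
    · obtain ⟨hpX, hp1, -⟩ := hmem p hp
      exact E.pos_nonneg _ (hp1 ▸ (hzc p hpX).1)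
    · obtain ⟨hpX, hp1, -⟩ := hmem p hp
      exact E.pos_le _ (hp1 ▸ (hzc p hpX).1)
    · have hne : p.2 ≠ q.2 := fun h =>
        hpq (Prod.ext ((hmem p hp).2.1.trans (hmem q hq).2.1.symm) h)
      rcases hne.lt_or_gt with h | h
      · exact hsep p hp q hq h
      · rw [abs_sub_comm]
        exact hsep q hq p hp h
  rw [Finset.card_eq_sum_card_fiberwise hmaps, Nat.cast_sum]
  refine (Finset.sum_le_card_nsmul _ _ _ hfib).trans (le_of_eq ?_)
  rw [Finset.card_product, nsmul_eq_mul]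
  push_cast
  ring

lemma card_crossings_le_sq (A : Finset ℕ) (S N : ℕ → Finset V) :
    (crossings A S N).card ≤ A.card ^ 2 := by
  refine (Finset.card_filter_le _ _).trans ?_
  rw [Finset.card_product, sq]

end IsGreedyRun

end greedy

/-! ### The Moore bound. -/

section moore

variable {V : Type*} [DecidableEq V]

/-- One round of breadth-first search: the ball `B` with its search edges `τ` is enlarged by all
neighbours of `B` along `E`. -/
lemma exists_bfs_step {E : Finset (Sym2 V)} {U B : Finset V} {τ : Finset (Sym2 V)} {v : V} {r : ℕ}
    (hE : ∀ e ∈ E, ∀ x ∈ e, x ∈ U) (hB : B ⊆ U) (hτ : τ ⊆ E) (hc : τ.card + 1 ≤ B.card)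
    (hr : ∀ x ∈ B, ∃ P ⊆ τ, P.card ≤ r ∧ (fromEdgeSet (P : Set (Sym2 V))).Reachable v x) :
    ∃ (B' : Finset V) (τ' : Finset (Sym2 V)), B ⊆ B' ∧ B' ⊆ U ∧ τ ⊆ τ' ∧ τ' ⊆ E ∧
      τ'.card + 1 ≤ B'.card ∧
      (∀ x ∈ B', ∃ P ⊆ τ', P.card ≤ r + 1 ∧ (fromEdgeSet (P : Set (Sym2 V))).Reachable v x) ∧
      ∀ x ∈ B, ∀ y, s(x, y) ∈ E → y ∈ B' := by
  classical
  set D : Finset V := (U \ B).filter fun y => ∃ x ∈ B, s(x, y) ∈ E with hD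
  have hpar : ∀ y ∈ D, ∃ x ∈ B, s(x, y) ∈ E := fun y hy => (Finset.mem_filter.1 hy).2
  choose! par hpB hpE using hpar
  have hdisj : Disjoint B D := Finset.disjoint_left.2 fun x hx hxD =>
    (Finset.mem_sdiff.1 (Finset.mem_filter.1 hxD).1).2 hx
  refine ⟨B ∪ D, τ ∪ D.image (fun y => s(par y, y)), Finset.subset_union_left,
    Finset.union_subset hB ((Finset.filter_subset _ _).trans Finset.sdiff_subset),
    Finset.subset_union_left, Finset.union_subset hτ ?_, ?_, ?_, ?_⟩
  · intro e he
    obtain ⟨y, hy, rfl⟩ := Finset.mem_image.1 he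
    exact hpE y hy
  · have h1 := Finset.card_union_le τ (D.image fun y => s(par y, y))
    have h2 : (D.image fun y => s(par y, y)).card ≤ D.card := Finset.card_image_le
    rw [Finset.card_union_of_disjoint hdisj]
    omega
  · intro x hx
    rcases Finset.mem_union.1 hx with hx | hx
    · obtain ⟨P, hP, hPc, hPr⟩ := hr x hx
      exact ⟨P, hP.trans Finset.subset_union_left, by omega, hPr⟩
    · obtain ⟨P, hP, hPc, hPr⟩ := hr _ (hpB x hx)
      refine ⟨insert s(par x, x) P, ?_, (Finset.card_insert_le _ _).trans (by omega), ?_⟩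
      · refine Finset.insert_subset ?_ (hP.trans Finset.subset_union_left)
        exact Finset.mem_union_right _ (Finset.mem_image_of_mem _ hx)
      · refine (hPr.mono (fromEdgeSet_mono (by simp))).trans (Adj.reachable ?_)
        rw [fromEdgeSet_adj]
        exact ⟨by simp, fun h => Finset.disjoint_left.1 hdisj (hpB x hx) (by rwa [h])⟩
  · intro x hx y hxy
    by_cases hy : y ∈ B
    · exact Finset.mem_union_left _ hy
    · refine Finset.mem_union_right _ (Finset.mem_filter.2 ⟨?_, x, hx, hxy⟩)
      exact Finset.mem_sdiff.2 ⟨hE _ hxy y (by simp), hy⟩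

/-- **Moore bound**: if `E` contains no cycle of length at most `2 * k` and its vertices lie in
`U`, then `E` has at most `|U| ^ (1 + 1 / k)` edges. -/
theorem card_edges_le_of_girth {k : ℕ} (hk : 1 ≤ k) {D : ℝ} (hD : 0 ≤ D) (E : Finset (Sym2 V))
    (U : Finset V) (hU : (U.card : ℝ) ≤ D ^ k) (hE : ∀ e ∈ E, ∀ x ∈ e, x ∈ U)
    (hgirth : ∀ P ⊆ E, P.card < 2 * k → ∀ x y, s(x, y) ∈ E → s(x, y) ∉ P →
      ¬ (fromEdgeSet (P : Set (Sym2 V))).Reachable x y) :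
    (E.card : ℝ) ≤ U.card * D := by
  classical
  induction U using Finset.strongInduction generalizing E with
  | H U ih =>
  obtain rfl | ⟨v, hv⟩ := U.eq_empty_or_nonempty
  · have : E = ∅ := by
      refine Finset.eq_empty_of_forall_notMem fun e he => ?_
      induction e with
      | _ x y => simpa using hE _ he x (by simp)
    simp [this]
  have good : ∃ r < k, ∃ (B B' : Finset V) (τ : Finset (Sym2 V)), v ∈ B ∧ B ⊆ U ∧
      (B'.card : ℝ) ≤ D * B.card ∧ τ ⊆ E ∧ τ.card ≤ B'.card ∧
      (∀ x ∈ B, ∃ P ⊆ τ, P.card ≤ r ∧ (fromEdgeSet (P : Set (Sym2 V))).Reachable v x) ∧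
      (∀ x ∈ B', ∃ P ⊆ τ, P.card ≤ r + 1 ∧ (fromEdgeSet (P : Set (Sym2 V))).Reachable v x) ∧
      ∀ x ∈ B, ∀ y, s(x, y) ∈ E → y ∈ B' := by
    -- If each of `k` rounds of search multiplied the ball by more than `D`, it would exceed `D ^
    -- k`, hence `U`. So some round `r < k` has small growth.
    by_contra hno
    have grow : ∀ r ≤ k, ∃ (B : Finset V) (τ : Finset (Sym2 V)), v ∈ B ∧ B ⊆ U ∧ τ ⊆ E ∧
        τ.card + 1 ≤ B.card ∧ D ^ r ≤ (B.card : ℝ) ∧ (r = k → D ^ r < (B.card : ℝ)) ∧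
        ∀ x ∈ B, ∃ P ⊆ τ, P.card ≤ r ∧ (fromEdgeSet (P : Set (Sym2 V))).Reachable v x := by
      intro r
      induction r with
      | zero =>
        intro _
        refine ⟨{v}, ∅, by simp, by simpa using hv, by simp, by simp, by simp,
          fun h => by omega, fun x hx => ⟨∅, by simp, by simp, ?_⟩⟩
        rw [Finset.mem_singleton.1 hx]
      | succ r ihr =>
        intro hr
        obtain ⟨B, τ, hvB, hB, hτ, hc, hlow, -, hreach⟩ := ihr (by omega)
        obtain ⟨B', τ', hBB', hB', hττ', hτ', hc', hreach', hnb⟩ :=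
          exists_bfs_step hE hB hτ hc hreach
        have hgt : D * B.card < B'.card := by
          by_contra hle
          refine hno ⟨r, by omega, B, B', τ', hvB, hB, not_lt.1 hle, hτ', by omega,
            fun x hx => ?_, hreach', hnb⟩
          obtain ⟨P, hP, h⟩ := hreach x hx
          exact ⟨P, hP.trans hττ', h⟩
        have hpow : D ^ (r + 1) ≤ D * B.card := by
          rw [pow_succ']
          gcongr
        exact ⟨B', τ', hBB' hvB, hB', hτ', hc', (hpow.trans hgt.le), fun _ => hpow.trans_lt hgt,
          hreach'⟩
    obtain ⟨B, -, -, hB, -, -, -, hgt, -⟩ := grow k le_rfl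
    have h1 := hgt rfl
    have h2 : (B.card : ℝ) ≤ U.card := by exact_mod_cast Finset.card_le_card hB
    linarith
  obtain ⟨r, hr, B, B', τ, hvB, hB, hBB', hτ, hc, hreach, hreach', hnb⟩ := good
  -- An edge touching `B` outside the search tree would close a cycle with at most `r + (r + 1)`
  -- tree edges, fewer than `2 * k`. So deleting `B` costs at most `D * B.card` edges, and induction
  -- applies to the rest.
  have hsub : E.filter (fun e => ∃ x ∈ B, x ∈ e) ⊆ τ := by
    intro e he
    obtain ⟨heE, x, hx, hxe⟩ := Finset.mem_filter.1 he
    obtain ⟨y, rfl⟩ := Sym2.mem_iff_exists.1 hxe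
    by_contra hnot
    obtain ⟨P, hP, hPc, hPr⟩ := hreach x hx
    obtain ⟨Q, hQ, hQc, hQr⟩ := hreach' y (hnb x hx y heE)
    refine hgirth (P ∪ Q) ((Finset.union_subset hP hQ).trans hτ)
      ((Finset.card_union_le _ _).trans_lt (by omega)) x y heE
      (fun h => hnot (Finset.union_subset hP hQ h)) ?_
    exact (hPr.mono (fromEdgeSet_mono (by simp))).symm.trans (hQr.mono (fromEdgeSet_mono (by simp)))
  have hrest := ih (U \ B) (Finset.sdiff_ssubset hB ⟨v, hvB⟩)
    (E.filter fun e => ¬ ∃ x ∈ B, x ∈ e)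
    (le_trans (by exact_mod_cast Finset.card_le_card Finset.sdiff_subset) hU)
    (fun e he x hxe => by
      obtain ⟨heE, hno⟩ := Finset.mem_filter.1 he
      exact Finset.mem_sdiff.2 ⟨hE e heE x hxe, fun hxB => hno ⟨x, hxB, hxe⟩⟩)
    (fun P hP hPc x y hxy => hgirth P (hP.trans (Finset.filter_subset _ _)) hPc x y
      (Finset.mem_filter.1 hxy).1)
  have hsplit := Finset.card_filter_add_card_filter_not (s := E) (fun e => ∃ x ∈ B, x ∈ e)
  have h1 : ((E.filter fun e => ∃ x ∈ B, x ∈ e).card : ℝ) ≤ D * B.card :=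
    le_trans (by exact_mod_cast (Finset.card_le_card hsub).trans hc) hBB'
  have h2 : ((U \ B).card : ℝ) = U.card - B.card := by
    rw [Finset.card_sdiff_of_subset hB, Nat.cast_sub (Finset.card_le_card hB)]
  rw [h2] at hrest
  rw [← hsplit]
  push_cast
  linarith

end moore

/-! ### Girth of the graph of added terminal pairs. -/

/-- The graph on the terminals whose edges are the pairs `a i, b i` for `i ∈ I`. -/
def demandGraph {V : Type*} (a b : ℕ → V) (I : Finset ℕ) : SimpleGraph V :=
  fromEdgeSet {e | ∃ i ∈ I, s(a i, b i) = e}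

section greedy

variable {V : Type*} {G : SimpleGraph V} {w : Sym2 V → ℝ} {T : Finset V} {t : ℝ}
  {A : Finset ℕ} {H : ℕ → SimpleGraph V} {a b : ℕ → V} {S N : ℕ → Finset V} {len : ℕ → ℝ}
  {pos : ℕ → V → ℝ}

lemma demandGraph_mono {I J : Finset ℕ} (h : I ⊆ J) : demandGraph a b I ≤ demandGraph a b J :=
  fromEdgeSet_mono fun _ ⟨i, hi, he⟩ => ⟨i, h hi, he⟩

lemma length_le_card_of_isPath {I : Finset ℕ} {x y : V} (p : (demandGraph a b I).Walk x y)
    (hp : p.IsPath) : p.length ≤ I.card := by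
  classical
  rw [← Walk.length_edges, ← List.toFinset_card_of_nodup hp.isTrail.edges_nodup]
  refine (Finset.card_le_card (t := I.image fun i => s(a i, b i)) fun e he => ?_).trans
    Finset.card_image_le
  have := p.edges_subset_edgeSet (List.mem_toFinset.1 he)
  rw [demandGraph, edgeSet_fromEdgeSet] at this
  obtain ⟨⟨i, hi, rfl⟩, -⟩ := this
  exact Finset.mem_image_of_mem _ hi

lemma WReach.of_walk {H K : SimpleGraph V} {ℓ : ℝ} (h : ∀ x y, K.Adj x y → WReach w H x y ℓ)
    {x y : V} (p : K.Walk x y) : WReach w H x y (p.length * ℓ) := by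
  induction p with
  | nil => exact WReach.refl _ (by simp)
  | cons hadj p ih =>
    refine ((h _ _ hadj).trans ih).mono le_rfl (le_of_eq ?_)
    rw [Walk.length_cons]
    push_cast
    ring

namespace IsGreedyRun

/-- Each earlier pair is joined in `H j` at length at most `len j`. A path of at most `t` such pairs
would therefore already `t`-span pair `j`. -/
lemma not_reachable_of_lt (R : IsGreedyRun G w T t A H a b S N len pos) {I : Finset ℕ}
    (hI : I ⊆ A) (ht : (I.card : ℝ) ≤ t) {j : ℕ} (hj : j ∈ A) (hlt : ∀ i ∈ I, i < j) :
    ¬ (demandGraph a b I).Reachable (a j) (b j) := by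
  intro hr
  obtain ⟨p, hp⟩ := hr.exists_isPath
  refine R.not_reach j hj ((WReach.of_walk (ℓ := len j) ?_ p).mono le_rfl ?_)
  · intro x y hxy
    obtain ⟨⟨i, hi, he⟩, -⟩ := (fromEdgeSet_adj _).1 hxy
    have h := (R.ext i (hI hi)).reach_ends.mono (R.mono (hlt i hi))
      (R.len_mono i (hI hi) j hj (hlt i hi).le)
    rcases Sym2.eq_iff.1 he with ⟨h1, h2⟩ | ⟨h1, h2⟩
    · rwa [h1, h2] at h
    · rw [h1, h2] at h
      exact h.symm
  · have : (p.length : ℝ) ≤ I.card := by exact_mod_cast length_le_card_of_isPath p hp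
    exact mul_le_mul_of_nonneg_right (this.trans ht) (R.len_pos j hj).le

lemma ends_ne (R : IsGreedyRun G w T t A H a b S N len pos) (ht : 0 ≤ t) {j : ℕ} (hj : j ∈ A) :
    a j ≠ b j := fun h =>
  R.not_reachable_of_lt (Finset.empty_subset A) (by simpa) hj (by simp) (h ▸ Reachable.refl _)

lemma ends_injOn (R : IsGreedyRun G w T t A H a b S N len pos) (ht : 1 ≤ t) :
    Set.InjOn (fun i => s(a i, b i)) A := by
  have key : ∀ i ∈ A, ∀ j ∈ A, i < j → s(a i, b i) ≠ s(a j, b j) := by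
    intro i hi j hj hij he
    refine R.not_reachable_of_lt (I := {i}) (by simpa) (by simpa) hj (by simpa)
      (Adj.reachable ?_)
    exact (fromEdgeSet_adj _).2 ⟨⟨i, by simp, he⟩, R.ends_ne (by linarith) hj⟩
  intro i hi j hj he
  rcases lt_trichotomy i j with h | h | h
  · exact absurd he (key i hi j hj h)
  · exact h
  · exact absurd he.symm (key j hj i hi h)

/-- Insert the pairs in time order: each one joins two distinct components. The last pair needs only
the others to number at most `t`, whence the bound `t + 1`. -/
lemma isAcyclic_demandGraph (R : IsGreedyRun G w T t A H a b S N len pos) {I : Finset ℕ}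
    (hI : I ⊆ A) (ht : (I.card : ℝ) ≤ t + 1) : (demandGraph a b I).IsAcyclic := by
  classical
  induction I using Finset.induction_on_max with
  | empty => simp [demandGraph]
  | insert j I hlt ih =>
    have hj : j ∉ I := fun h => lt_irrefl _ (hlt j h)
    rw [Finset.card_insert_of_notMem hj] at ht
    push_cast at ht
    have hIA : I ⊆ A := (Finset.subset_insert j I).trans hI
    have : demandGraph a b (insert j I) = demandGraph a b I ⊔ edge (a j) (b j) := by
      rw [demandGraph, demandGraph, edge, ← fromEdgeSet_union]
      congr 1
      ext e
      simp [eq_comm]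
    rw [this]
    exact (ih hIA (by linarith)).sup_edge_of_not_reachable
      (R.not_reachable_of_lt hIA (by linarith) (hI (by simp)) hlt)

/-- This removes the time order: in the forest on `insert j I` the edge of `j` is a bridge, so `I`
alone cannot connect its ends. -/
lemma not_reachable (R : IsGreedyRun G w T t A H a b S N len pos) (ht1 : 1 ≤ t) {I : Finset ℕ}
    (hI : I ⊆ A) (ht : (I.card : ℝ) ≤ t) {j : ℕ} (hj : j ∈ A) (hjI : j ∉ I) :
    ¬ (demandGraph a b I).Reachable (a j) (b j) := by
  classical
  intro hr
  have hac := R.isAcyclic_demandGraph (Finset.insert_subset hj hI) (by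
    rw [Finset.card_insert_of_notMem hjI]
    push_cast
    linarith)
  have hadj : (demandGraph a b (insert j I)).Adj (a j) (b j) :=
    (fromEdgeSet_adj _).2 ⟨⟨j, by simp, rfl⟩, R.ends_ne (by linarith) hj⟩
  have hbr := isAcyclic_iff_forall_isBridge.1 hac ((mem_edgeSet _).2 hadj)
  refine isBridge_iff.1 hbr (hr.mono fun x y hxy => ?_)
  rw [deleteEdges_adj]
  refine ⟨demandGraph_mono (Finset.subset_insert j I) hxy, fun he => ?_⟩
  obtain ⟨⟨i, hi, hie⟩, -⟩ := (fromEdgeSet_adj _).1 hxy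
  exact hjI (R.ends_injOn ht1 (hI hi) hj (hie.trans he) ▸ hi)

lemma card_le_mul (R : IsGreedyRun G w T t A H a b S N len pos) (ht1 : 1 ≤ t) {k : ℕ}
    (hk : 1 ≤ k) (hkt : (2 * k : ℝ) ≤ t + 1) {D : ℝ} (hD : 0 ≤ D) (hT : (T.card : ℝ) ≤ D ^ k) :
    (A.card : ℝ) ≤ T.card * D := by
  classical
  rw [← Finset.card_image_of_injOn (R.ends_injOn ht1)]
  refine card_edges_le_of_girth hk hD _ T hT ?_ ?_
  · intro e he x hx
    obtain ⟨i, hi, rfl⟩ := Finset.mem_image.1 he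
    rcases Sym2.mem_iff.1 hx with rfl | rfl
    · exact R.left_mem i hi
    · exact R.right_mem i hi
  · intro P hP hPc x y hxy hxyP hr
    obtain ⟨I, hI, rfl⟩ := Finset.subset_image_iff.1 hP
    obtain ⟨j, hj, hje⟩ := Finset.mem_image.1 hxy
    have hI' : I ⊆ A := hI
    rw [Finset.card_image_of_injOn ((R.ends_injOn ht1).mono hI)] at hPc
    have hjI : j ∉ I := fun h => hxyP (hje ▸ Finset.mem_image_of_mem _ h)
    have hPc' : (I.card : ℝ) + 1 ≤ 2 * k := by exact_mod_cast hPc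
    refine R.not_reachable ht1 hI' (by linarith) hj hjI ?_
    have hset : ((I.image fun i => s(a i, b i) : Finset (Sym2 V)) : Set (Sym2 V)) =
        {e | ∃ i ∈ I, s(a i, b i) = e} := by
      ext e
      simp
    rw [hset] at hr
    rcases Sym2.eq_iff.1 hje with ⟨h1, h2⟩ | ⟨h1, h2⟩
    · rw [h1, h2]
      exact hr
    · rw [h1, h2]
      exact hr.symm

end IsGreedyRun

end greedy

/-! ### Numerical estimates and conclusion. -/

/-- Geometric interpolation of the two bounds, for stretch `2 * τ + 1`. The factor `2 / τ` blows up
as `τ` tends to zero, but its exponent then vanishes linearly. -/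
lemma le_exp_mul_sq_of_le {N X τ : ℝ} (hN : 1 ≤ N) (hX : 0 ≤ X) (hτ : 0 < τ) (hτ1 : τ ≤ 1)
    (h1 : X ≤ N ^ 4) (h2 : X ≤ N ^ 3 * (2 / τ + 1)) :
    X ≤ Real.exp 6 * (N ^ (1 + 2 / (2 * τ + 1 + 1))) ^ 2 := by
  have hN0 : 0 < N := by linarith
  -- The weight solving `4 * α + 3 * (1 - α) = 2 * (1 + 2 / (2 * τ + 2))`.
  set α : ℝ := (1 - τ) / (1 + τ)
  have hα0 : 0 ≤ α := div_nonneg (by linarith) (by linarith)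
  have hβ : 1 - α = 2 * τ / (1 + τ) := by
    simp only [α]
    field_simp
    ring
  have hβ0 : 0 ≤ 1 - α := by rw [hβ]; positivity
  have hβτ : 1 - α ≤ 2 * τ := by
    rw [hβ]
    exact div_le_self (by positivity) (by linarith)
  have hu : 1 ≤ 3 / τ := by rw [le_div_iff₀ hτ]; linarith
  have hu0 : 0 < 3 / τ := by positivity
  have h3 : X ≤ N ^ 3 * (3 / τ) := by
    refine h2.trans (mul_le_mul_of_nonneg_left ?_ (by positivity))
    have : 1 ≤ 1 / τ := by rw [le_div_iff₀ hτ]; linarith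
    have h3 : 3 / τ = 2 / τ + 1 / τ := by ring
    linarith
  have hexp : (3 / τ) ^ (1 - α) ≤ Real.exp 6 := by
    rw [Real.rpow_def_of_pos hu0]
    refine Real.exp_le_exp.2 ?_
    have hlog : Real.log (3 / τ) ≤ 3 / τ := Real.log_le_self hu0.le
    calc Real.log (3 / τ) * (1 - α) ≤ 3 / τ * (2 * τ) :=
          mul_le_mul hlog hβτ hβ0 hu0.le
      _ = 6 := by field_simp; norm_num
  have hpow : (N ^ 4) ^ α * (N ^ 3) ^ (1 - α) = (N ^ (1 + 2 / (2 * τ + 1 + 1))) ^ 2 := by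
    rw [← Real.rpow_natCast N 4, ← Real.rpow_natCast N 3, ← Real.rpow_mul hN0.le,
      ← Real.rpow_mul hN0.le, ← Real.rpow_add hN0, ← Real.rpow_natCast _ 2,
      ← Real.rpow_mul hN0.le]
    congr 1
    simp only [α]
    push_cast
    field_simp
    ring
  calc X = X ^ α * X ^ (1 - α) := by
        rw [← Real.rpow_add_of_nonneg hX hα0 hβ0]
        simp
    _ ≤ (N ^ 4) ^ α * (N ^ 3 * (3 / τ)) ^ (1 - α) := by gcongr
    _ = (3 / τ) ^ (1 - α) * ((N ^ 4) ^ α * (N ^ 3) ^ (1 - α)) := by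
        rw [Real.mul_rpow (by positivity) hu0.le]
        ring
    _ ≤ Real.exp 6 * (N ^ (1 + 2 / (2 * τ + 1 + 1))) ^ 2 := by
        rw [hpow]
        gcongr

lemma le_of_sq_le_mul_add {n m X Y : ℝ} (hn : 0 ≤ n) (hY : 0 ≤ Y)
    (hXY : X ≤ Y ^ 2) (h : m ^ 2 ≤ n * (m + 2 * X)) : m ≤ 2 * n + 2 * (√n * Y) := by
  -- When `m > 2 * n`, the term `n * m` is below half of `m ^ 2` and is absorbed, leaving `m ^ 2 ≤ 4
  -- * n * X`.
  rcases le_or_gt m (2 * n) with hmn | hmn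
  · have : 0 ≤ √n * Y := by positivity
    linarith
  · have h2 : m ^ 2 ≤ (2 * (√n * Y)) ^ 2 := by
      rw [mul_pow, mul_pow, Real.sq_sqrt hn]
      nlinarith [mul_le_mul_of_nonneg_left hXY hn]
    have := abs_le_of_sq_le_sq' h2 (by positivity)
    linarith [this.2]

lemma IsGreedyRun.card_crossings_le_exp {V : Type*} [DecidableEq V] {G : SimpleGraph V}
    {w : Sym2 V → ℝ} {T : Finset V} {t : ℝ} {A : Finset ℕ} {H : ℕ → SimpleGraph V} {a b : ℕ → V}
    {S N : ℕ → Finset V} {len : ℕ → ℝ} {pos : ℕ → V → ℝ}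
    (R : IsGreedyRun G w T t A H a b S N len pos) (ht : 1 ≤ t) :
    ((crossings A S N).card : ℝ) ≤ Real.exp 6 * ((T.card : ℝ) ^ (1 + 2 / (t + 1))) ^ 2 := by
  obtain hT | hT := T.eq_empty_or_nonempty
  · have hA : A = ∅ := Finset.eq_empty_of_forall_notMem fun i hi => by
      simpa [hT] using R.left_mem i hi
    have : crossings A S N = ∅ := by simp [crossings, hA]
    rw [this, Finset.card_empty, Nat.cast_zero]
    positivity
  have hN : (1 : ℝ) ≤ T.card := by exact_mod_cast hT.card_pos
  set n : ℝ := (T.card : ℝ)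
  have hn0 : 0 < n := by linarith
  rcases le_or_gt 3 t with h3 | h3
  · set k := ⌊(t + 1) / 2⌋₊
    have hk1 : 1 ≤ k := Nat.le_floor (by push_cast; linarith)
    have hk : (1 : ℝ) ≤ k := by exact_mod_cast hk1
    have hkt : (k : ℝ) ≤ (t + 1) / 2 := Nat.floor_le (by linarith)
    have hkt' : (t + 1) / 2 < k + 1 := Nat.lt_floor_add_one _
    have hA := R.card_le_mul ht hk1 (by linarith) (Real.rpow_nonneg hn0.le (1 / k))
      (by rw [← Real.rpow_natCast, ← Real.rpow_mul hn0.le, one_div_mul_cancel (by positivity),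
        Real.rpow_one])
    have hX := R.card_crossings_le one_pos (by linarith)
    have hexp : (3 : ℝ) ≤ Real.exp 6 := by
      have := Real.add_one_le_exp (6 : ℝ)
      linarith
    -- Rounding costs a factor two at most: `(t + 1) / 2 < k + 1 ≤ 2 * k`. The crossing bound
    -- tolerates this, as it needs only the exponent `4 / (t + 1)`.
    have hle : 1 / (k : ℝ) ≤ 2 / (t + 1) + 2 / (t + 1) := by
      rw [← add_div, div_le_div_iff₀ (by positivity) (by linarith)]
      linarith
    calc ((crossings A S N).card : ℝ) ≤ A.card * (n * (2 / 1 + 1)) := hX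
      _ ≤ n * n ^ (1 / (k : ℝ)) * (n * (2 / 1 + 1)) := by gcongr
      _ = 3 * (n * n * n ^ (1 / (k : ℝ))) := by ring
      _ ≤ Real.exp 6 * (n * n * n ^ (2 / (t + 1) + 2 / (t + 1))) := by
          gcongr
      _ = Real.exp 6 * (n ^ (1 + 2 / (t + 1))) ^ 2 := by
          rw [Real.rpow_add hn0, Real.rpow_add hn0, Real.rpow_one]
          ring
  -- For `t < 3` only `k = 1` is available, which is the trivial count of pairs.
  · have hA : (A.card : ℝ) ≤ n * n :=
      R.card_le_mul ht le_rfl (by push_cast; linarith) hn0.le (by simp [n])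
    have hX4 : ((crossings A S N).card : ℝ) ≤ n ^ 4 :=
      calc ((crossings A S N).card : ℝ) ≤ (A.card : ℝ) ^ 2 := by
            exact_mod_cast IsGreedyRun.card_crossings_le_sq A S N
        _ ≤ (n * n) ^ 2 := by gcongr
        _ = n ^ 4 := by ring
    rcases ht.eq_or_lt with rfl | ht1
    · have h2 : n ^ ((1 : ℝ) + 2 / (1 + 1)) = n ^ 2 := by
        rw [← Real.rpow_natCast]
        norm_num
      rw [h2]
      refine hX4.trans ?_
      have : n ^ 4 = (n ^ 2) ^ 2 := by ring
      rw [this]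
      exact le_mul_of_one_le_left (by positivity) (Real.one_le_exp (by norm_num))
    · have hτ : 0 < (t - 1) / 2 := by linarith
      have hX3 : ((crossings A S N).card : ℝ) ≤ n ^ 3 * (2 / ((t - 1) / 2) + 1) :=
        calc ((crossings A S N).card : ℝ) ≤ A.card * (n * (2 / ((t - 1) / 2) + 1)) :=
              R.card_crossings_le hτ (by linarith)
          _ ≤ n * n * (n * (2 / ((t - 1) / 2) + 1)) := by gcongr
          _ = n ^ 3 * (2 / ((t - 1) / 2) + 1) := by ring
      have := le_exp_mul_sq_of_le hN (Nat.cast_nonneg _) hτ (by linarith) hX4 hX3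
      rwa [show 2 * ((t - 1) / 2) + 1 = t by ring] at this

theorem mainTheorem6 :
    ∃ C : ℝ, 0 < C ∧
      ∀ (V : Type*) [Fintype V] (G : SimpleGraph V) (w : Sym2 V → ℝ),
        (∀ e ∈ G.edgeSet, 0 < w e) →
        ∀ (t : ℝ), 1 ≤ t → ∀ (T : Finset V),
          ∃ H : SimpleGraph V, IsSubsetSpanner G w T t H ∧
            (H.edgeSet.ncard : ℝ) ≤
              C * ((Fintype.card V : ℝ) +
                Real.sqrt (Fintype.card V : ℝ) * (T.card : ℝ) ^ (1 + 2 / (t + 1))) := by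
  -- The crossing bound enters under a square root, so `exp 6` becomes `exp 3`; the 2 comes from
  -- `le_of_sq_le_mul_add`.
  refine ⟨2 * Real.exp 3, by positivity, fun V _ G w hw t ht T => ?_⟩
  classical
  obtain hV | hV := isEmpty_or_nonempty V
  · refine ⟨⊥, ⟨bot_le, fun u => isEmptyElim u⟩, ?_⟩
    rw [edgeSet_bot, Set.ncard_empty, Nat.cast_zero]
    positivity
  obtain ⟨A, H, a, b, S, N, len, pos, M, R, hspan⟩ := exists_isGreedyRun hw ht T
  refine ⟨H M, hspan, ?_⟩
  have h1 : ((H M).edgeSet.ncard : ℝ) ≤ ∑ i ∈ A, ((N i).card : ℝ) := by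
    exact_mod_cast R.ncard_edgeSet_le
  have h2 : (∑ i ∈ A, ((N i).card : ℝ)) ^ 2 ≤
      Fintype.card V * (∑ i ∈ A, ((N i).card : ℝ) + 2 * (crossings A S N).card) := by
    exact_mod_cast R.sq_sum_fresh_le
  set q : ℝ := (T.card : ℝ) ^ (1 + 2 / (t + 1))
  have hX : ((crossings A S N).card : ℝ) ≤ (Real.exp 3 * q) ^ 2 := by
    refine (R.card_crossings_le_exp ht).trans (le_of_eq ?_)
    rw [mul_pow, ← Real.exp_nat_mul]
    norm_num [q]
  have h3 := le_of_sq_le_mul_add (Nat.cast_nonneg _) (by positivity) hX h2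
  have h4 : (Fintype.card V : ℝ) ≤ Real.exp 3 * Fintype.card V :=
    le_mul_of_one_le_left (Nat.cast_nonneg _) (Real.one_le_exp (by norm_num))
  calc ((H M).edgeSet.ncard : ℝ)
      ≤ 2 * Fintype.card V + 2 * (√(Fintype.card V : ℝ) * (Real.exp 3 * q)) := h1.trans h3
    _ ≤ 2 * (Real.exp 3 * Fintype.card V) + 2 * (√(Fintype.card V : ℝ) * (Real.exp 3 * q)) := by
        gcongr
    _ = 2 * Real.exp 3 * (Fintype.card V + √(Fintype.card V : ℝ) * q) := by ring
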